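/- All graphs are finite and simple. A perfect Roman dominating function (PRDF) of a graph $G=(V,E)$ is a function $f:V\to\{0,1,2\}$ such that every vertex $x$ with $f(x)=0$ is adjacent to exactly one vertex $y$ with $f(y)=2$. Its weight is $\sum_{x\in V}f(x)$, and the perfect Roman domination number $\gamma_R^p(G)$ is the minimum weight of a PRDF of $G$. The graph $G$ is perfect Roman domination stable if $\gamma_R^p(G-v)=\gamma_R^p(G)$ for every vertex $v$ of $G$. For a tree $T$, let $W(T)$ be the set of all vertices $x$ such that $f(x)=0$ for every PRDF $f$ of $T$ of weight $\gamma_R^p(T)$. Let $\mathcal{T}$ be the family of trees $T$ for which there is a sequence $T_1,\dots,T_k$ of trees, $k\ge 1$, such that $T_1$ is the path $P_3$, $T_k=T$ (trees being considered up to isomorphism), and for each $1\le i<k$ the tree $T_{i+1}$ is obtained from $T_i$ by choosing a vertex $u\in W(T_i)$ and adding a new path $v_3v_2v_1$ on three new vertices together with the edge $uv_3$. Theorem. Let $T$ be a tree of order $n\ge 3$. Then $T$ is perfect Roman domination stable if and only if $T\in\mathcal{T}$. -/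

import Mathlib

namespace PerfectRoman

universe u

/-- `f : V → {0, 1, 2}` is a perfect Roman dominating function (PRDF) of `G`: every vertex of
value `0` is adjacent to exactly one vertex of value `2`. -/
def IsPRDF {V : Type u} (G : SimpleGraph V) (f : V → Fin 3) : Prop :=
  ∀ x, f x = 0 → ∃! y, G.Adj x y ∧ f y = 2

/-- The weight of a function `V → {0, 1, 2}`. -/
def weight {V : Type u} [Fintype V] (f : V → Fin 3) : ℕ :=
  ∑ x, (f x : ℕ)

/-- The perfect Roman domination number: the minimum weight of a PRDF. (The set is never empty,
see `isPRDF_one`, so this infimum in `ℕ` is a minimum.) -/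
noncomputable def prdNumber {V : Type u} [Fintype V] (G : SimpleGraph V) : ℕ :=
  sInf {w | ∃ f : V → Fin 3, IsPRDF G f ∧ weight f = w}

theorem isPRDF_one {V : Type u} (G : SimpleGraph V) : IsPRDF G (fun _ => 1) := by
  intro x hx
  simp at hx

/-- A PRDF of minimum weight. -/
def IsMinPRDF {V : Type u} [Fintype V] (G : SimpleGraph V) (f : V → Fin 3) : Prop :=
  IsPRDF G f ∧ weight f = prdNumber G

/-- `G` is perfect Roman domination stable: removing any one vertex leaves the perfect Roman
domination number unchanged. -/
def IsStable {V : Type u} [Fintype V] [DecidableEq V] (G : SimpleGraph V) : Prop :=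
  ∀ v : V, prdNumber (G.induce ({v}ᶜ : Set V)) = prdNumber G

/-- The set `W(G)` of the vertices that have value `0` under every minimum weight PRDF. -/
def zeroSet {V : Type u} [Fintype V] (G : SimpleGraph V) : Set V :=
  {x | ∀ f : V → Fin 3, IsMinPRDF G f → f x = 0}

/-- `G` together with a new path `v₃v₂v₁` and the edge `xv₃`, where `v₃, v₂, v₁` are
`Sum.inr 0, Sum.inr 1, Sum.inr 2`. -/
def attachPath {V : Type u} (G : SimpleGraph V) (x : V) : SimpleGraph (V ⊕ Fin 3) :=
  (G ⊕g SimpleGraph.pathGraph 3) ⊔ SimpleGraph.edge (Sum.inl x) (Sum.inr 0)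

/-- The family `𝒯`, up to isomorphism: the graphs obtained from the path `P₃` by finitely many
(possibly no) steps, each of which attaches a path `v₃v₂v₁` by an edge `xv₃` at a vertex `x` of
the set `W` of the current graph. -/
inductive InFamily : ∀ {V : Type u} [Fintype V], SimpleGraph V → Prop
  | base {V : Type u} [Fintype V] (G : SimpleGraph V)
      (e : G ≃g SimpleGraph.pathGraph 3) : InFamily G
  | step {V V' : Type u} [Fintype V] [Fintype V'] (G : SimpleGraph V) (G' : SimpleGraph V')
      (hG : InFamily G) (x : V) (hx : x ∈ zeroSet G) (e : G' ≃g attachPath G x) : InFamily G'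

end PerfectRoman

/-!
Both properties of the tree `T` are equivalent to the existence of a path partition
(`IsPathPartition`): a PRDF `f` without the value `1` such that every vertex of value `2` has
exactly two neighbours, both of value `0`. The vertices of `T` then fall into paths of values `0,
2, 0`, and all other edges join ends of such paths.

*Path partitions and the family.* Let the cost of a function be its weight plus the number of its
undominated zeros. When a path is attached at a vertex of value `0`, the two ends of the new edge
may save one unit of cost through this edge, but only where the function already differs from the
partition; hence, by induction, `f` is the unique function of minimum cost (`IsRigid.attachPath`).
In particular `f` is the only PRDF of minimum weight, and `W` is the set of its zeros. So every
graph in the family has a path partition with this rigidity (`InFamily.exists_isPathPartition`).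
Conversely, in a tree with a path partition a minimal branch behind an edge that joins two paths
is a pendant path, and removing it leaves a smaller tree with a path partition
(`IsPathPartition.inFamily_and_isRigid`).

*Path partitions and stability.* A PRDF of `T - v` amounts to a PRDF of `T` with the value `1` at
`v`. So `T` is stable if and only if, for every `v`, the minimum weight of such a PRDF is one more
than the minimum weight for `T`. Rigidity and dissolving the path through `v` give this for a tree
with a path partition (`IsPathPartition.isStable`).

For the converse, let `f` be a PRDF of minimum weight of a stable tree. It does not take the value
`1`. Dissolving the star of a `2`-vertex shows that the latter has at least two neighbours of
value `0`. If it has a third one, comparison with a minimum weight PRDF of `T - v` on the branches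
at `v` yields a minimum weight PRDF with two adjacent `2`s (`IsStable.exists_adj_two`, which rests
on the exchange argument `IsStable.weightOn_lt`). Adjacent `2`s are impossible: following them
away from a given one, we would find a `2`-vertex that can be given the value `0`
(`IsStable.not_adj_two_two`). Therefore `f` is a path partition (`IsStable.isPathPartition`).
-/

namespace PerfectRoman

universe u

/-! ### Perfect Roman dominating functions and vertex deletion -/

section Basic

variable {V : Type u} {G : SimpleGraph V} {f g : V → Fin 3}

theorem eq_two_of_ne {a : Fin 3} (h0 : a ≠ 0) (h1 : a ≠ 1) : a = 2 := by omega

/-- The condition that a PRDF imposes at the single vertex `x`. -/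
def DominatedAt (G : SimpleGraph V) (f : V → Fin 3) (x : V) : Prop :=
  f x = 0 → ∃! y, G.Adj x y ∧ f y = 2

theorem DominatedAt.congr {x : V} (h : DominatedAt G f x) (hx : g x = 0 → f x = 0)
    (hy : ∀ y, G.Adj x y → (g y = 2 ↔ f y = 2)) : DominatedAt G g x := by
  intro h0
  obtain ⟨y, ⟨hxy, hy2⟩, huniq⟩ := h (hx h0)
  exact ⟨y, ⟨hxy, (hy y hxy).2 hy2⟩, fun z hz => huniq z ⟨hz.1, (hy z hz.1).1 hz.2⟩⟩

theorem dominatedAt_of_ne {x : V} (h : f x ≠ 0) : DominatedAt G f x := fun h0 => absurd h0 h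

theorem IsPRDF.eq_of_adj (hf : IsPRDF G f) {x y z : V} (hx : f x = 0) (hy : G.Adj x y)
    (hy2 : f y = 2) (hz : G.Adj x z) (hz2 : f z = 2) : y = z :=
  (hf x hx).unique ⟨hy, hy2⟩ ⟨hz, hz2⟩

/-- Raising a value `0` to `1` neither creates nor destroys a dominating vertex. -/
theorem IsPRDF.update_one [DecidableEq V] (hf : IsPRDF G f) {x : V} (hx : f x ≠ 2) :
    IsPRDF G (Function.update f x 1) := by
  intro z
  by_cases hz : z = x
  · subst hz
    exact dominatedAt_of_ne (by simp)
  · refine DominatedAt.congr (hf z) (by simp [hz]) fun y _ => ?_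
    by_cases hy : y = x
    · subst hy
      simp [hx]
    · simp [hy]

open scoped Classical in
/-- `f` with the star of the `2`-vertex `v` dissolved: `v` gets the value `a`, and its neighbours
of value `0` get the value `1`. -/
noncomputable def dissolve (G : SimpleGraph V) (f : V → Fin 3) (v : V) (a : Fin 3) : V → Fin 3 :=
  fun z => if z = v then a else if G.Adj v z ∧ f z = 0 then 1 else f z

theorem dissolve_self (v : V) (a : Fin 3) : dissolve G f v a v = a := by simp [dissolve]

theorem dissolve_adj {v z : V} (a : Fin 3) (h : G.Adj v z) (hz : f z = 0) :
    dissolve G f v a z = 1 := by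
  simp [dissolve, h, hz, h.ne']

theorem dissolve_eq_two_iff {v z : V} (a : Fin 3) (h : z ≠ v) :
    dissolve G f v a z = 2 ↔ f z = 2 := by
  unfold dissolve
  rw [if_neg h]
  split_ifs with h'
  · simp [h'.2]
  · rfl

theorem dissolve_dominatedAt (hf : IsPRDF G f) {v z : V} (a : Fin 3) (hz : z ≠ v) :
    DominatedAt G (dissolve G f v a) z := by
  intro h0
  have h : ¬ G.Adj v z ∧ f z = 0 := by
    unfold dissolve at h0
    rw [if_neg hz] at h0
    by_cases h' : G.Adj v z ∧ f z = 0
    · simp [h'] at h0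
    rw [if_neg h'] at h0
    exact ⟨fun h => h' ⟨h, h0⟩, h0⟩
  refine DominatedAt.congr (hf z) (fun _ => h.2) (fun y hy => ?_) h0
  exact dissolve_eq_two_iff a fun e => h.1 (e ▸ hy.symm)

variable [Fintype V]

theorem prdNumber_le (hf : IsPRDF G f) : prdNumber G ≤ weight f := Nat.sInf_le ⟨f, hf, rfl⟩

theorem exists_isMinPRDF (G : SimpleGraph V) : ∃ f, IsMinPRDF G f := by
  have := Nat.sInf_mem (s := {w | ∃ f : V → Fin 3, IsPRDF G f ∧ weight f = w})
    ⟨_, _, isPRDF_one G, rfl⟩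
  exact this

theorem weight_update_one_of_zero [DecidableEq V] {x : V} (hx : f x = 0) :
    weight (Function.update f x 1) = weight f + 1 := by
  unfold weight
  rw [← Finset.add_sum_erase _ _ (Finset.mem_univ x),
    ← Finset.add_sum_erase (a := x) _ (fun z => (f z : ℕ)) (Finset.mem_univ x)]
  rw [Finset.sum_congr rfl (g := fun z => (f z : ℕ))]
  · simp [hx, add_comm]
  · intro z hz
    rw [Function.update_of_ne (Finset.ne_of_mem_erase hz)]

open scoped Classical in
theorem weight_dissolve {v : V} (hv : f v = 2) (a : Fin 3) :
    weight (dissolve G f v a) + 2 =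
      weight f + a + (Finset.univ.filter fun z => G.Adj v z ∧ f z = 0).card := by
  unfold weight
  rw [← Finset.add_sum_erase _ _ (Finset.mem_univ v),
    ← Finset.add_sum_erase (a := v) _ (fun z => (f z : ℕ)) (Finset.mem_univ v),
    dissolve_self, hv]
  have h1 : (Finset.univ.filter fun z => G.Adj v z ∧ f z = 0) =
      (Finset.univ.erase v).filter fun z => G.Adj v z ∧ f z = 0 := by
    ext z
    simp only [Finset.mem_filter, Finset.mem_univ, true_and, Finset.mem_erase, and_true]
    exact ⟨fun h => ⟨h.1.ne', h⟩, fun h => h.2⟩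
  have h2 : ∑ z ∈ Finset.univ.erase v, (dissolve G f v a z : ℕ) =
      ∑ z ∈ Finset.univ.erase v, (f z : ℕ) +
        (Finset.univ.filter fun z => G.Adj v z ∧ f z = 0).card := by
    rw [h1, Finset.card_filter, ← Finset.sum_add_distrib]
    refine Finset.sum_congr rfl fun z hz => ?_
    have hz' := Finset.ne_of_mem_erase hz
    unfold dissolve
    rw [if_neg hz']
    split_ifs with h
    · simp [h.2]
    · simp
  rw [h2]
  simp
  ring

/-- A PRDF of `G - v` is the same thing as a PRDF of `G` with the value `1` at `v`: such a vertex
neither dominates a neighbour nor has to be dominated. -/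
theorem prdNumber_induce_add_one_le [DecidableEq V] {v : V} (hf : IsPRDF G f) (hv : f v = 1) :
    prdNumber (G.induce ({v}ᶜ : Set V)) + 1 ≤ weight f := by
  have h1 : IsPRDF (G.induce ({v}ᶜ : Set V)) (fun z => f z) := by
    intro z hz
    obtain ⟨y, ⟨hy, hy2⟩, huniq⟩ := hf z hz
    have hyv : y ≠ v := by
      rintro rfl
      simp [hv] at hy2
    exact ⟨⟨y, hyv⟩, ⟨hy, hy2⟩, fun w hw => Subtype.ext (huniq w hw)⟩
  have h2 := prdNumber_le h1
  have h3 : weight f = 1 + weight (fun z : ({v}ᶜ : Set V) => f z) := by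
    unfold weight
    rw [← Finset.add_sum_erase _ _ (Finset.mem_univ v), hv]
    congr 1
    refine Finset.sum_subtype _ (fun x => ?_) fun z => (f z : ℕ)
    simp
  omega

theorem exists_isPRDF_of_induce [DecidableEq V] (G : SimpleGraph V) (v : V) :
    ∃ f, IsPRDF G f ∧ f v = 1 ∧ weight f = prdNumber (G.induce ({v}ᶜ : Set V)) + 1 := by
  obtain ⟨h, hh, hw⟩ := exists_isMinPRDF (G.induce ({v}ᶜ : Set V))
  let f : V → Fin 3 := fun z => if hz : z = v then 1 else h ⟨z, hz⟩
  have hfv : f v = 1 := by simp [f]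
  have hfz : ∀ z : ({v}ᶜ : Set V), f z = h z := fun z => dif_neg z.2
  refine ⟨f, ?_, hfv, ?_⟩
  · intro z hz
    have hzv : z ≠ v := by
      rintro rfl
      simp [hfv] at hz
    obtain ⟨y, ⟨hy, hy2⟩, huniq⟩ := hh ⟨z, hzv⟩ ((hfz ⟨z, hzv⟩).symm.trans hz)
    refine ⟨y, ⟨hy, (hfz y).trans hy2⟩, fun w hw => ?_⟩
    have hwv : w ≠ v := by
      rintro rfl
      simp [hfv] at hw
    exact congrArg Subtype.val
      (huniq ⟨w, hwv⟩ ⟨hw.1, (hfz ⟨w, hwv⟩).symm.trans hw.2⟩)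
  · rw [← hw]
    unfold weight
    rw [← Finset.add_sum_erase _ _ (Finset.mem_univ v), hfv, add_comm]
    congr 1
    rw [Finset.sum_subtype (p := fun z => z ∈ ({v}ᶜ : Set V)) _ (fun x => by simp)]
    exact Finset.sum_congr rfl fun z _ => by rw [hfz]

end Basic

/-! ### Partitions into paths on three vertices -/

section Rigid

variable {V : Type u} {G : SimpleGraph V} {f : V → Fin 3}

/-- `f` is a PRDF with values in `{0, 2}`, and every vertex of value `2` has exactly two
neighbours, both of value `0`. Equivalently, the vertices of `G` are partitioned into paths on three
vertices whose middle vertices (those of value `2`) have degree `2` in `G`. -/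
structure IsPathPartition (G : SimpleGraph V) (f : V → Fin 3) : Prop where
  isPRDF : IsPRDF G f
  ne_one : ∀ x, f x ≠ 1
  center : ∀ x, f x = 2 → ∃ p q, p ≠ q ∧ f p = 0 ∧ f q = 0 ∧ ∀ w, G.Adj x w ↔ w = p ∨ w = q

open scoped Classical in
/-- The weight of `f`, plus one for every vertex of value `0` with no neighbour of value `2`. -/
noncomputable def cost [Fintype V] (G : SimpleGraph V) (f : V → Fin 3) : ℕ :=
  ∑ x, ((f x : ℕ) + if f x = 0 ∧ ∀ y, G.Adj x y → f y ≠ 2 then 1 else 0)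

/-- `f` is the unique minimizer of `cost`, among all functions. -/
def IsRigid [Fintype V] (G : SimpleGraph V) (f : V → Fin 3) : Prop :=
  ∀ g, g ≠ f → weight f + 1 ≤ cost G g

theorem IsPRDF.cost_eq [Fintype V] (hf : IsPRDF G f) : cost G f = weight f := by
  unfold cost weight
  refine Finset.sum_congr rfl fun x _ => ?_
  rw [if_neg, add_zero]
  rintro ⟨h0, h⟩
  obtain ⟨y, ⟨hy, hy2⟩, -⟩ := hf x h0
  exact h y hy hy2

theorem IsRigid.lt_weight [Fintype V] (h : IsRigid G f) {g : V → Fin 3} (hg : IsPRDF G g)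
    (hne : g ≠ f) : weight f + 1 ≤ weight g := hg.cost_eq ▸ h g hne

theorem IsRigid.prdNumber_eq [Fintype V] (h : IsRigid G f) (hf : IsPRDF G f) :
    prdNumber G = weight f := by
  refine le_antisymm (prdNumber_le hf) ?_
  obtain ⟨g, hg, hw⟩ := exists_isMinPRDF G
  rw [← hw]
  by_cases hne : g = f
  · rw [hne]
  · exact (Nat.le_succ _).trans (h.lt_weight hg hne)

theorem IsRigid.eq_of_isMinPRDF [Fintype V] (h : IsRigid G f) (hf : IsPRDF G f) {g : V → Fin 3}
    (hg : IsMinPRDF G g) : g = f := by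
  by_contra hne
  have h1 := h.lt_weight hg.1 hne
  have h2 := hg.2
  rw [h.prdNumber_eq hf] at h2
  omega

theorem IsPathPartition.isStable [Fintype V] [DecidableEq V] (hf : IsPathPartition G f)
    (h : IsRigid G f) : IsStable G := by
  classical
  intro v
  rw [h.prdNumber_eq hf.isPRDF]
  apply le_antisymm
  · -- Dissolve the path of the partition that contains `v`.
    obtain ⟨b, hb, hvb⟩ : ∃ b, f b = 2 ∧ (v = b ∨ (G.Adj b v ∧ f v = 0)) := by
      by_cases h0 : f v = 0
      · obtain ⟨b, hb, -⟩ := hf.isPRDF v h0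
        exact ⟨b, hb.2, Or.inr ⟨hb.1.symm, h0⟩⟩
      · exact ⟨v, eq_two_of_ne h0 (hf.ne_one v), Or.inl rfl⟩
    have hF : IsPRDF G (dissolve G f b 1) := by
      intro z
      by_cases hz : z = b
      · exact dominatedAt_of_ne (by simp [hz, dissolve_self])
      · exact dissolve_dominatedAt hf.isPRDF 1 hz
    have hFv : dissolve G f b 1 v = 1 := by
      rcases hvb with rfl | ⟨h1, h2⟩
      · exact dissolve_self _ _
      · exact dissolve_adj _ h1 h2
    have h1 := prdNumber_induce_add_one_le hF hFv
    have h2 := weight_dissolve (G := G) hb 1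
    obtain ⟨p, q, hpq, hp, hq, hadj⟩ := hf.center b hb
    have h3 : (Finset.univ.filter fun z => G.Adj b z ∧ f z = 0).card ≤ 2 := by
      refine (Finset.card_le_card (t := {p, q}) fun z hz => ?_).trans Finset.card_le_two
      simpa using (hadj z).1 (by simpa using (Finset.mem_filter.1 hz).2.1)
    have h4 : ((1 : Fin 3) : ℕ) = 1 := rfl
    omega
  · obtain ⟨g, hg, hgv, hw⟩ := exists_isPRDF_of_induce G v
    have h1 := h.lt_weight hg fun e => hf.ne_one v (e ▸ hgv)
    omega

/-! #### Invariance under isomorphism -/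

section Iso

variable {V' : Type*} {G' : SimpleGraph V'}

theorem IsPathPartition.comp_iso (hf : IsPathPartition G f) (e : G' ≃g G) :
    IsPathPartition G' (f ∘ e) where
  isPRDF x hx := by
    obtain ⟨y, ⟨hy, hy2⟩, huniq⟩ := hf.isPRDF (e x) hx
    refine ⟨e.symm y, ⟨?_, by simpa using hy2⟩, fun z hz => ?_⟩
    · rw [← e.map_adj_iff]
      simpa using hy
    · rw [← huniq (e z) ⟨e.map_adj_iff.2 hz.1, hz.2⟩]
      simp
  ne_one x := hf.ne_one (e x)
  center x hx := by
    obtain ⟨p, q, hpq, hp, hq, h⟩ := hf.center (e x) hx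
    refine ⟨e.symm p, e.symm q, by simpa using hpq, by simpa using hp, by simpa using hq,
      fun w => ?_⟩
    rw [← e.map_adj_iff, h, ← e.injective.eq_iff, ← e.injective.eq_iff]
    simp

theorem weight_comp_equiv [Fintype V] [Fintype V'] (e : V' ≃ V) (f : V → Fin 3) :
    weight (f ∘ e) = weight f :=
  Equiv.sum_comp e fun z => (f z : ℕ)

theorem cost_comp_iso [Fintype V] [Fintype V'] (e : G' ≃g G) (f : V → Fin 3) :
    cost G' (f ∘ e) = cost G f := by
  unfold cost
  rw [← Equiv.sum_comp e.toEquiv]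
  refine Finset.sum_congr rfl fun x _ => ?_
  have h : (∀ y, G'.Adj x y → f (e y) ≠ 2) ↔ ∀ y, G.Adj (e x) y → f y ≠ 2 := by
    rw [e.toEquiv.forall_congr_left]
    refine forall_congr' fun y => ?_
    have h1 : e (e.toEquiv.symm y) = y := e.apply_symm_apply y
    rw [← e.map_adj_iff, h1]
  simp only [Function.comp_apply]
  congr 2
  exact propext (and_congr_right' h)

theorem IsRigid.comp_iso [Fintype V] [Fintype V'] (h : IsRigid G f) (e : G' ≃g G) :
    IsRigid G' (f ∘ e) := by
  intro g hg
  have h1 := h (g ∘ e.symm) fun e' => hg (by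
    rw [← e']
    ext
    simp)
  rw [cost_comp_iso] at h1
  exact (weight_comp_equiv e.toEquiv f).symm ▸ h1

end Iso

/-! #### Attaching a path -/

/-- The minimum weight PRDF of the path on three vertices. -/
def pathFun : Fin 3 → Fin 3 := ![0, 2, 0]

theorem isPathPartition_pathFun : IsPathPartition (SimpleGraph.pathGraph 3) pathFun where
  isPRDF := by
    intro x hx
    refine ⟨1, ⟨?_, rfl⟩, fun y hy => ?_⟩
    · rw [SimpleGraph.pathGraph_adj]
      revert hx
      revert x
      decide
    · have key : ∀ y, pathFun y = 2 → y = 1 := by decide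
      exact key y hy.2
  ne_one := by decide
  center := by
    intro x hx
    refine ⟨0, 2, by decide, rfl, rfl, ?_⟩
    simp only [SimpleGraph.pathGraph_adj]
    revert hx
    revert x
    decide

theorem cost_pathGraph (g : Fin 3 → Fin 3) : cost (SimpleGraph.pathGraph 3) g =
    (g 0 + if g 0 = 0 ∧ g 1 ≠ 2 then 1 else 0) +
      (g 1 + if g 1 = 0 ∧ g 0 ≠ 2 ∧ g 2 ≠ 2 then 1 else 0) +
      (g 2 + if g 2 = 0 ∧ g 1 ≠ 2 then 1 else 0) := by
  simp [cost, Fin.sum_univ_three, Fin.forall_fin_succ, SimpleGraph.pathGraph_adj]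

theorem isRigid_pathFun : IsRigid (SimpleGraph.pathGraph 3) pathFun := by
  intro g hg
  have key : ∀ a b c : Fin 3, ¬ (a = 0 ∧ b = 2 ∧ c = 0) →
      2 + 1 ≤ ((a : ℕ) + if a = 0 ∧ b ≠ 2 then 1 else 0) +
        (b + if b = 0 ∧ a ≠ 2 ∧ c ≠ 2 then 1 else 0) + (c + if c = 0 ∧ b ≠ 2 then 1 else 0) := by
    decide
  rw [cost_pathGraph]
  refine key _ _ _ fun h => hg ?_
  ext i
  fin_cases i <;> simp [pathFun, h]

variable {x : V}

theorem attachPath_adj_inl_inl {a b : V} :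
    (attachPath G x).Adj (Sum.inl a) (Sum.inl b) ↔ G.Adj a b := by
  simp [attachPath, SimpleGraph.edge_adj]

theorem attachPath_adj_inr_inr {a b : Fin 3} :
    (attachPath G x).Adj (Sum.inr a) (Sum.inr b) ↔ (SimpleGraph.pathGraph 3).Adj a b := by
  simp [attachPath, SimpleGraph.edge_adj]

theorem attachPath_adj_inl_inr {a : V} {b : Fin 3} :
    (attachPath G x).Adj (Sum.inl a) (Sum.inr b) ↔ a = x ∧ b = 0 := by
  simp [attachPath, SimpleGraph.edge_adj]

theorem attachPath_adj_inr_inl {a : V} {b : Fin 3} :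
    (attachPath G x).Adj (Sum.inr b) (Sum.inl a) ↔ a = x ∧ b = 0 := by
  rw [SimpleGraph.adj_comm, attachPath_adj_inl_inr]

theorem IsPathPartition.attachPath (hf : IsPathPartition G f) (hx : f x = 0) :
    IsPathPartition (attachPath G x) (Sum.elim f pathFun) where
  isPRDF := by
    rintro (a | a) ha
    · obtain ⟨y, ⟨hy, hy2⟩, huniq⟩ := hf.isPRDF a ha
      refine ⟨Sum.inl y, ⟨attachPath_adj_inl_inl.2 hy, hy2⟩, ?_⟩
      rintro (z | z) ⟨hz, hz2⟩
      · rw [huniq z ⟨attachPath_adj_inl_inl.1 hz, hz2⟩]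
      · obtain ⟨-, rfl⟩ := attachPath_adj_inl_inr.1 hz
        simp [pathFun] at hz2
    · obtain ⟨y, ⟨hy, hy2⟩, huniq⟩ := isPathPartition_pathFun.isPRDF a ha
      refine ⟨Sum.inr y, ⟨attachPath_adj_inr_inr.2 hy, hy2⟩, ?_⟩
      rintro (z | z) ⟨hz, hz2⟩
      · obtain ⟨rfl, -⟩ := attachPath_adj_inr_inl.1 hz
        simp [hx] at hz2
      · rw [huniq z ⟨attachPath_adj_inr_inr.1 hz, hz2⟩]
  ne_one := by
    rintro (a | a)
    · exact hf.ne_one a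
    · exact isPathPartition_pathFun.ne_one a
  center := by
    rintro (a | a) ha
    · obtain ⟨p, q, hpq, hp, hq, h⟩ := hf.center a ha
      refine ⟨Sum.inl p, Sum.inl q, by simpa using hpq, hp, hq, ?_⟩
      rintro (w | w)
      · rw [attachPath_adj_inl_inl, h]
        simp
      · rw [attachPath_adj_inl_inr]
        have : a ≠ x := by
          rintro rfl
          simp [hx] at ha
        simp [this]
    · obtain ⟨p, q, hpq, hp, hq, h⟩ := isPathPartition_pathFun.center a ha
      refine ⟨Sum.inr p, Sum.inr q, by simpa using hpq, hp, hq, ?_⟩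
      rintro (w | w)
      · rw [attachPath_adj_inr_inl]
        have : a ≠ 0 := by
          rintro rfl
          simp [pathFun] at ha
        simp [this]
      · rw [attachPath_adj_inr_inr, h]
        simp

theorem sum_le_sum_add {ι : Type*} [Fintype ι] {F H : ι → ℕ} {d : ℕ} (i : ι)
    (h : ∀ j, j ≠ i → F j ≤ H j) (hi : F i ≤ H i + d) : ∑ j, F j ≤ ∑ j, H j + d := by
  classical
  rw [← Finset.add_sum_erase _ _ (Finset.mem_univ i),
    ← Finset.add_sum_erase _ H (Finset.mem_univ i)]
  have := Finset.sum_le_sum fun j (hj : j ∈ Finset.univ.erase i) => h j (Finset.ne_of_mem_erase hj)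
  omega

open scoped Classical in
/-- Deleting the edge that joins the path to `G` raises the cost by at most one, and only if one of
the two ends of that edge is dominated through it alone. -/
theorem cost_add_cost_le [Fintype V] (G : SimpleGraph V) (x : V) (g : V ⊕ Fin 3 → Fin 3) :
    cost G (g ∘ Sum.inl) + cost (SimpleGraph.pathGraph 3) (g ∘ Sum.inr) ≤
      cost (attachPath G x) g +
        (if (g (Sum.inl x) = 0 ∧ (∀ y, G.Adj x y → g (Sum.inl y) ≠ 2)) ∧ g (Sum.inr 0) = 2
          then 1 else 0) +
        (if g (Sum.inl x) = 2 ∧ g (Sum.inr 0) = 0 ∧ g (Sum.inr 1) ≠ 2 then 1 else 0) := by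
  have h1 : cost G (g ∘ Sum.inl) ≤
      (∑ a, ((g (Sum.inl a) : ℕ) + if g (Sum.inl a) = 0 ∧
        ∀ y, (attachPath G x).Adj (Sum.inl a) y → g y ≠ 2 then 1 else 0)) +
      (if (g (Sum.inl x) = 0 ∧ (∀ y, G.Adj x y → g (Sum.inl y) ≠ 2)) ∧ g (Sum.inr 0) = 2
          then 1 else 0) := by
    refine sum_le_sum_add x (fun a ha => ?_) ?_
    · simp [Sum.forall, attachPath_adj_inl_inl, attachPath_adj_inl_inr, ha]
    · simp only [Function.comp_apply, Sum.forall, attachPath_adj_inl_inl, attachPath_adj_inl_inr]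
      by_cases h0 : g (Sum.inr 0) = 2 <;> simp [h0]
  have h2 : cost (SimpleGraph.pathGraph 3) (g ∘ Sum.inr) ≤
      (∑ a, ((g (Sum.inr a) : ℕ) + if g (Sum.inr a) = 0 ∧
        ∀ y, (attachPath G x).Adj (Sum.inr a) y → g y ≠ 2 then 1 else 0)) +
      (if g (Sum.inl x) = 2 ∧ g (Sum.inr 0) = 0 ∧ g (Sum.inr 1) ≠ 2 then 1 else 0) := by
    refine sum_le_sum_add 0 (fun a ha => ?_) ?_
    · simp [Sum.forall, attachPath_adj_inr_inl, attachPath_adj_inr_inr, ha]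
      exact le_of_eq (by congr)
    · simp only [Function.comp_apply, Sum.forall, attachPath_adj_inr_inl, attachPath_adj_inr_inr,
        SimpleGraph.pathGraph_adj, Fin.forall_fin_succ]
      by_cases h0 : g (Sum.inl x) = 2 <;> by_cases h1 : g (Sum.inr 0) = 0 <;> simp [h0, h1]
  have h3 : cost (attachPath G x) g = _ := Fintype.sum_sum_type _
  rw [h3]
  omega

theorem IsRigid.attachPath [Fintype V] (h : IsRigid G f) (hf : IsPRDF G f) (hx : f x = 0) :
    IsRigid (attachPath G x) (Sum.elim f pathFun) := by
  classical
  intro g hg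
  have hsum : weight (Sum.elim f pathFun) = weight f + 2 := Fintype.sum_sum_type _
  have hle := cost_add_cost_le G x g
  have hp2 : weight pathFun = 2 := rfl
  have hG : g ∘ Sum.inl = f → cost G (g ∘ Sum.inl) = weight f := fun e => by rw [e, hf.cost_eq]
  have hP : g ∘ Sum.inr = pathFun → cost (SimpleGraph.pathGraph 3) (g ∘ Sum.inr) = 2 := fun e => by
    rw [e, isPathPartition_pathFun.isPRDF.cost_eq, hp2]
  have hG' := h (g ∘ Sum.inl)
  have hP' := isRigid_pathFun (g ∘ Sum.inr)
  have hne : ¬ (g ∘ Sum.inl = f ∧ g ∘ Sum.inr = pathFun) := fun e => hg (by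
    rw [← e.1, ← e.2, Sum.elim_comp_inl_inr])
  have hGx : g ∘ Sum.inl = f → g (Sum.inl x) = 0 := fun e => (congrFun e x).trans hx
  have hP0 : g ∘ Sum.inr = pathFun → g (Sum.inr 0) = 0 ∧ g (Sum.inr 1) = 2 := fun e =>
    ⟨congrFun e 0, congrFun e 1⟩
  have hGd : g ∘ Sum.inl = f → ¬ ∀ y, G.Adj x y → g (Sum.inl y) ≠ 2 := fun e hall => by
    obtain ⟨y, ⟨hy, hy2⟩, -⟩ := hf x hx
    exact hall y hy ((congrFun e y).trans hy2)
  rw [hsum]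
  by_cases e1 : g ∘ Sum.inl = f <;> by_cases e2 : g ∘ Sum.inr = pathFun
  · exact absurd ⟨e1, e2⟩ hne
  · have := hG e1
    have := hP' e2
    rw [if_neg fun hc => hGd e1 hc.1.2, if_neg fun hc => by simp [hGx e1] at hc] at hle
    omega
  · have := hG' e1
    have := hP e2
    rw [if_neg fun hc => by simp [hP0 e2] at hc, if_neg fun hc => hc.2.2 (hP0 e2).2] at hle
    omega
  · have := hG' e1
    have := hP' e2
    have hx : ¬ (g (Sum.inl x) = 0 ∧ g (Sum.inl x) = 2) := by
      rintro ⟨h0, h2⟩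
      simp [h0] at h2
    split_ifs at hle <;> omega

theorem InFamily.exists_isPathPartition [Fintype V] (h : InFamily G) :
    ∃ f, IsPathPartition G f ∧ IsRigid G f := by
  induction h with
  | base G e => exact ⟨_, isPathPartition_pathFun.comp_iso e, isRigid_pathFun.comp_iso e⟩
  | step G G' _ x hx e ih =>
    obtain ⟨f, hf, hr⟩ := ih
    have hx0 : f x = 0 := hx f ⟨hf.isPRDF, (hr.prdNumber_eq hf.isPRDF).symm⟩
    exact ⟨_, (hf.attachPath hx0).comp_iso e, (hr.attachPath hf.isPRDF hx0).comp_iso e⟩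

end Rigid

/-! ### Branches of a tree -/

section Branch

variable {V : Type u} {T : SimpleGraph V} {v w z : V}

/-- The component that contains `w` of the graph obtained from `T` by deleting the vertex `v`. -/
def branch (T : SimpleGraph V) (v w : V) : Set V :=
  {z | (T.deleteIncidenceSet v).Reachable w z}

theorem mem_branch_self (T : SimpleGraph V) (v w : V) : w ∈ branch T v w :=
  SimpleGraph.Reachable.refl _

theorem branch_induction {P : V → Prop} (hw : P w)
    (step : ∀ a b, T.Adj a b → a ≠ v → b ≠ v → P a → P b) : ∀ z ∈ branch T v w, P z := by
  intro z hz
  rw [branch, Set.mem_ofPred_eq, SimpleGraph.reachable_iff_reflTransGen] at hz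
  induction hz with
  | refl => exact hw
  | tail _ h ih =>
    rw [SimpleGraph.deleteIncidenceSet_adj] at h
    exact step _ _ h.1 h.2.1 h.2.2 ih

theorem ne_of_mem_branch (h : w ≠ v) (hz : z ∈ branch T v w) : z ≠ v :=
  branch_induction (P := (· ≠ v)) h (fun _ _ _ _ hb _ => hb) z hz

theorem mem_branch_of_adj {y : V} (hz : z ∈ branch T v w) (h : T.Adj z y) (hzv : z ≠ v)
    (hyv : y ≠ v) : y ∈ branch T v w :=
  SimpleGraph.Reachable.trans hz
    (SimpleGraph.Adj.reachable (SimpleGraph.deleteIncidenceSet_adj.2 ⟨h, hzv, hyv⟩))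

theorem eq_of_mem_branch (hT : T.IsAcyclic) {w' : V} (hw : T.Adj v w) (hw' : T.Adj v w')
    (h : w' ∈ branch T v w) : w' = w := by
  by_contra hne
  have hb := SimpleGraph.isAcyclic_iff_forall_adj_isBridge.1 hT hw
  rw [SimpleGraph.isBridge_iff] at hb
  refine hb ?_
  have h1 : (T \ SimpleGraph.fromEdgeSet {s(v, w)}).Reachable w w' := by
    refine SimpleGraph.Reachable.mono (fun a b hab => ?_) h
    rw [SimpleGraph.deleteIncidenceSet_adj] at hab
    simp [hab.1, hab.2.1, hab.2.2]
  refine SimpleGraph.Reachable.trans (SimpleGraph.Adj.reachable ?_) h1.symm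
  simp [hw', hne, hw.ne]

theorem mem_branch_unique {w' : V} (hT : T.IsAcyclic) (hw : T.Adj v w) (hw' : T.Adj v w')
    (h : z ∈ branch T v w) (h' : z ∈ branch T v w') : w = w' :=
  (eq_of_mem_branch hT hw hw' (SimpleGraph.Reachable.trans h h'.symm)).symm

/-- The edge `vw` is the only one that leaves the branch at `w`. -/
theorem eq_of_adj_of_notMem_branch (hT : T.IsAcyclic) (hw : T.Adj v w) {y : V}
    (hz : z ∈ branch T v w) (h : T.Adj z y) (hy : y ∉ branch T v w) : z = w ∧ y = v := by
  have hyv : y = v := by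
    by_contra hyv
    exact hy (mem_branch_of_adj hz h (ne_of_mem_branch hw.ne' hz) hyv)
  subst hyv
  exact ⟨eq_of_mem_branch hT hw h.symm hz, rfl⟩

theorem exists_mem_branch (hT : T.Connected) (hz : z ≠ v) :
    ∃ w, T.Adj v w ∧ z ∈ branch T v w := by
  have h := hT.preconnected v z
  rw [SimpleGraph.reachable_iff_reflTransGen] at h
  induction h with
  | refl => exact absurd rfl hz
  | @tail b c _ h ih =>
    by_cases hb : b = v
    · subst hb
      exact ⟨c, h, mem_branch_self _ _ _⟩
    · obtain ⟨w, hw, hbw⟩ := ih hb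
      exact ⟨w, hw, mem_branch_of_adj hbw h hb hz⟩

theorem branch_subset_branch (hT : T.IsAcyclic) {w' : V} (hw : T.Adj v w) (hw' : T.Adj w w')
    (hne : w' ≠ v) : branch T w w' ⊆ branch T v w := by
  refine branch_induction (mem_branch_of_adj (mem_branch_self _ _ _) hw' hw.ne' hne) ?_
  intro a b hab ha _ has
  by_contra hb
  exact ha (eq_of_adj_of_notMem_branch hT hw has hab hb).1

theorem branch_ssubset_branch (hT : T.IsAcyclic) {w' : V} (hw : T.Adj v w) (hw' : T.Adj w w')
    (hne : w' ≠ v) : branch T w w' ⊂ branch T v w :=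
  ⟨branch_subset_branch hT hw hw' hne, fun h =>
    ne_of_mem_branch hw'.ne' (h (mem_branch_self T v w)) rfl⟩

theorem notMem_branch_symm (hT : T.IsAcyclic) (hw : T.Adj v w) (hz : z ∈ branch T w v) :
    z ∉ branch T v w := by
  refine branch_induction (P := (· ∉ branch T v w)) (fun h => ne_of_mem_branch hw.ne' h rfl) ?_ z hz
  intro a b hab _ hb has hbs
  exact hb (eq_of_adj_of_notMem_branch hT hw hbs hab.symm has).1

end Branch

/-! ### Exchanging values on a set of vertices -/

section Exchange

variable {V : Type u} {T : SimpleGraph V} {f g : V → Fin 3} {S : Set V}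

open scoped Classical in
/-- The function that is `g` on `S` and `f` elsewhere. -/
noncomputable def glue (S : Set V) (g f : V → Fin 3) : V → Fin 3 :=
  fun z => if z ∈ S then g z else f z

theorem glue_of_mem {z : V} (h : z ∈ S) : glue S g f z = g z := if_pos h

theorem glue_of_notMem {z : V} (h : z ∉ S) : glue S g f z = f z := if_neg h

open scoped Classical in
/-- The total value of `f` on `S`. -/
noncomputable def weightOn [Fintype V] (S : Set V) (f : V → Fin 3) : ℕ :=
  ∑ z, if z ∈ S then (f z : ℕ) else 0

theorem weightOn_congr [Fintype V] (h : ∀ z ∈ S, f z = g z) : weightOn S f = weightOn S g := by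
  unfold weightOn
  refine Finset.sum_congr rfl fun z _ => ?_
  split_ifs with hz
  · rw [h z hz]
  · rfl

theorem weight_glue [Fintype V] (S : Set V) (g f : V → Fin 3) :
    weight (glue S g f) + weightOn S f = weight f + weightOn S g := by
  unfold weight weightOn glue
  rw [← Finset.sum_add_distrib, ← Finset.sum_add_distrib]
  refine Finset.sum_congr rfl fun z _ => ?_
  split_ifs
  · exact add_comm _ _
  · rfl

theorem weightOn_update_one_of_zero [Fintype V] [DecidableEq V] {c : V} (hc : c ∈ S) (h : g c = 0) :
    weightOn S (Function.update g c 1) = weightOn S g + 1 := by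
  have h1 := weight_glue S (Function.update g c 1) (Function.update g c 1)
  have h2 := weight_glue S (Function.update g c 1) g
  have h3 : glue S (Function.update g c 1) g = Function.update g c 1 := by
    ext z
    by_cases hz : z ∈ S
    · rw [glue_of_mem hz]
    · rw [glue_of_notMem hz, Function.update_of_ne (by rintro rfl; exact hz hc)]
  rw [h3, weight_update_one_of_zero h] at h2
  omega

variable {u v : V}

/-- Functions on the two sides of the edge `vu` may be glued, provided that the ends of the edge see
no difference across it. -/
theorem IsPRDF.glue (hT : T.IsAcyclic) (h : T.Adj v u) (hg : IsPRDF T g) (hf : IsPRDF T f)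
    (hu : g u ≠ 0 ∨ (f v = 2 ↔ g v = 2)) (hv : f v ≠ 0 ∨ (g u = 2 ↔ f u = 2)) :
    IsPRDF T (glue (branch T v u) g f) := by
  intro z
  have hvS : v ∉ branch T v u := fun hS => ne_of_mem_branch h.ne' hS rfl
  by_cases hz : z ∈ branch T v u
  · by_cases hzu : z = u ∧ g u ≠ 0
    · exact dominatedAt_of_ne (by rw [glue_of_mem hz, hzu.1]; exact hzu.2)
    refine DominatedAt.congr (hg z) (by rw [glue_of_mem hz]; exact id) fun y hy => ?_
    by_cases hyS : y ∈ branch T v u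
    · rw [glue_of_mem hyS]
    · obtain ⟨rfl, rfl⟩ := eq_of_adj_of_notMem_branch hT h hz hy hyS
      rw [glue_of_notMem hyS]
      tauto
  · by_cases hzv : z = v ∧ f v ≠ 0
    · exact dominatedAt_of_ne (by rw [glue_of_notMem hz, hzv.1]; exact hzv.2)
    refine DominatedAt.congr (hf z) (by rw [glue_of_notMem hz]; exact id) fun y hy => ?_
    by_cases hyS : y ∈ branch T v u
    · obtain ⟨rfl, rfl⟩ := eq_of_adj_of_notMem_branch hT h hyS hy.symm hz
      rw [glue_of_mem hyS]
      tauto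
    · rw [glue_of_notMem hyS]

open scoped Classical in
theorem weight_eq_add_sum_branch [Fintype V] (hT : T.IsTree) (v : V) (f : V → Fin 3) :
    weight f = f v + ∑ c ∈ Finset.univ.filter (T.Adj v), weightOn (branch T v c) f := by
  unfold weight weightOn
  rw [← Finset.add_sum_erase _ _ (Finset.mem_univ v), Finset.sum_comm,
    ← Finset.add_sum_erase (a := v) Finset.univ
      (fun z => ∑ c ∈ Finset.univ.filter (T.Adj v), if z ∈ branch T v c then (f z : ℕ) else 0)
      (Finset.mem_univ v)]
  congr 1
  rw [Finset.sum_eq_zero (fun c hc => if_neg fun h =>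
    ne_of_mem_branch (Finset.mem_filter.1 hc).2.ne' h rfl), zero_add]
  refine Finset.sum_congr rfl fun z hz => ?_
  obtain ⟨w, hw, hzw⟩ := exists_mem_branch hT.1 (Finset.ne_of_mem_erase hz)
  rw [Finset.sum_eq_single_of_mem w (by simpa using hw), if_pos hzw]
  intro c hc hcw
  exact if_neg fun hzc =>
    hcw (mem_branch_unique hT.2 (Finset.mem_filter.1 hc).2 hw hzc hzw)

end Exchange

/-! ### Minimum weight PRDFs of a stable tree -/

section Stable

variable {V : Type u} [Fintype V] {T : SimpleGraph V} {f g : V → Fin 3} {u v w : V}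

theorem IsStable.lt_weight [DecidableEq V] (h : IsStable T) {x : V} (hf : IsPRDF T f)
    (hx : f x = 1) : prdNumber T < weight f := by
  have h1 := prdNumber_induce_add_one_le hf hx
  rw [h x] at h1
  exact h1

theorem IsStable.ne_one [DecidableEq V] (h : IsStable T) (hf : IsPRDF T f)
    (hw : weight f ≤ prdNumber T) (x : V) : f x ≠ 1 := fun hx =>
  absurd (h.lt_weight hf hx) (by omega)

/-- Let `f` be a minimum weight PRDF of a stable tree in which `v` dominates its neighbour `u`. Then
no PRDF that dominates `u` from a vertex of the branch at `u` is as cheap as `f` on that branch.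

Let `x` be the vertex that dominates `u` in `g`. Comparing `f` and `g` outside the branch at `x`
shows that `g` is as cheap as `f` on that branch; also, `f` dominates `x` from some further vertex
`y`. Deleting `x` shows that `f` is as cheap as possible on each branch at `x`, up to the cost of
replacing a value `0` by `1`, and on the branches other than that at `y` even this difference is
excluded, as it would produce a minimum weight PRDF with a value `1`. Summing over the branches at
`x` now shows that `g`, which spends `2` on `x`, is too expensive. -/
theorem IsStable.weightOn_lt [DecidableEq V] (h : IsStable T) (hT : T.IsTree) (hf : IsMinPRDF T f)
    (huv : T.Adj v u) (hv : f v = 2) (hu : f u = 0) (hg : IsPRDF T g) (hgu : g u = 0)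
    (hgv : g v ≠ 2) : weightOn (branch T v u) f < weightOn (branch T v u) g := by
  classical
  by_contra! hle
  obtain ⟨hfP, hfw⟩ := hf
  obtain ⟨x, ⟨hux, hx2⟩, hxuniq⟩ := hg u hgu
  have hxv : x ≠ v := fun e => hgv (e ▸ hx2)
  have hsub := branch_subset_branch hT.2 huv hux hxv
  have huS := mem_branch_self T v u
  have hxS := mem_branch_self T u x
  have huSx : u ∉ branch T u x := fun hS => ne_of_mem_branch hux.ne' hS rfl
  have hvS : v ∉ branch T v u := fun hS => ne_of_mem_branch huv.ne' hS rfl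
  have hfx2 : f x ≠ 2 := fun e => hxv (hfP.eq_of_adj hu hux e huv.symm hv)
  -- `g` on the branch at `u` without the branch at `x`, and `f` everywhere else.
  set F₁ := PerfectRoman.glue (branch T v u) g f with hF₁
  set F := PerfectRoman.glue (branch T u x) f F₁ with hF
  have hFx : ∀ z ∈ branch T u x, F z = f z := fun z hz => glue_of_mem hz
  have hFu : ∀ z ∈ branch T v u, z ∉ branch T u x → F z = g z := fun z hz hz' => by
    rw [hF, glue_of_notMem hz', hF₁, glue_of_mem hz]
  have hFv : ∀ z, z ∉ branch T v u → F z = f z := fun z hz => by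
    rw [hF, glue_of_notMem fun hz' => hz (hsub hz'), hF₁, glue_of_notMem hz]
  have hFP : IsPRDF T F := by
    intro z
    by_cases hzx : z ∈ branch T u x
    · refine DominatedAt.congr (hfP z) (by rw [hFx z hzx]; exact id) fun y hy => ?_
      by_cases hyx : y ∈ branch T u x
      · rw [hFx y hyx]
      · obtain ⟨rfl, rfl⟩ := eq_of_adj_of_notMem_branch hT.2 hux hzx hy hyx
        rw [hFu y huS huSx, hgu, hu]
    by_cases hzu : z ∈ branch T v u
    · by_cases hz : z = u
      · subst hz
        intro _
        refine ⟨v, ⟨huv.symm, (hFv v hvS).trans hv⟩, fun y hy => ?_⟩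
        by_contra hyv
        by_cases hyx : y ∈ branch T z x
        · have := (eq_of_adj_of_notMem_branch hT.2 hux hyx hy.1.symm huSx).1
          subst this
          exact hfx2 ((hFx y hyx).symm.trans hy.2)
        · have hyu := mem_branch_of_adj huS hy.1 huv.ne' hyv
          have := hxuniq y ⟨hy.1, (hFu y hyu hyx).symm.trans hy.2⟩
          subst this
          exact hyx hxS
      · refine DominatedAt.congr (hg z) (by rw [hFu z hzu hzx]; exact id) fun y hy => ?_
        have hyu : y ∈ branch T v u := by
          by_contra hyu
          exact hz (eq_of_adj_of_notMem_branch hT.2 huv hzu hy hyu).1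
        have hyx : y ∉ branch T u x := fun hyx =>
          hz (eq_of_adj_of_notMem_branch hT.2 hux hyx hy.symm hzx).2
        rw [hFu y hyu hyx]
    · by_cases hz : z = v
      · exact dominatedAt_of_ne (by rw [hFv z hzu, hz, hv]; decide)
      · refine DominatedAt.congr (hfP z) (by rw [hFv z hzu]; exact id) fun y hy => ?_
        have hyu : y ∉ branch T v u := fun hyu =>
          hz (eq_of_adj_of_notMem_branch hT.2 huv hyu hy.symm hzu).2
        rw [hFv y hyu]
  have hlex : weightOn (branch T u x) g ≤ weightOn (branch T u x) f := by
    have h1 := prdNumber_le hFP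
    have h2 := weight_glue (branch T u x) f F₁
    have h3 := weight_glue (branch T v u) g f
    have h4 : weightOn (branch T u x) F₁ = weightOn (branch T u x) g :=
      weightOn_congr fun z hz => glue_of_mem (hsub hz)
    rw [← hF] at h2
    rw [← hF₁] at h3
    omega
  have hfx : f x = 0 := by
    by_contra h0
    exact hfx2 (eq_two_of_ne h0 (h.ne_one hfP hfw.le x))
  obtain ⟨y, ⟨hxy, hy2⟩, -⟩ := hfP x hfx
  -- `g` on the branch at `x`, and `f` everywhere else.
  set G := PerfectRoman.glue (branch T u x) g f with hG
  have hGw := weight_glue (branch T u x) g f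
  rw [← hG] at hGw
  have hGc : ∀ c, T.Adj x c → c ≠ u → ∀ z ∈ branch T x c, G z = g z := fun c hc hcu z hz =>
    glue_of_mem (branch_subset_branch hT.2 hux hc hcu hz)
  have hbound : ∀ c, T.Adj x c → c ≠ u →
      weightOn (branch T x c) f ≤ weightOn (branch T x c) G + if c = y then 1 else 0 := by
    intro c hc hcu
    rw [weightOn_congr (hGc c hc hcu)]
    have hxc : x ∉ branch T x c := fun hS => ne_of_mem_branch hc.ne' hS rfl
    have hfx1 : Function.update f x 1 x = 1 := by simp
    have hfup := hfP.update_one hfx2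
    have hfuw := weight_update_one_of_zero hfx
    have hfuc : weightOn (branch T x c) (Function.update f x 1) = weightOn (branch T x c) f :=
      weightOn_congr fun z hz => Function.update_of_ne (ne_of_mem_branch hc.ne' hz) _ _
    by_cases hgc : g c = 0
    · have hgup := hg.update_one (x := c) (by simp [hgc])
      have hguw := weightOn_update_one_of_zero (mem_branch_self T x c) hgc
      have hg1 : Function.update g c 1 c = 1 := by simp
      -- The exchange that makes `x` and `c` equal to `1` loses at most one.
      have hA : weightOn (branch T x c) f ≤ weightOn (branch T x c) g + 1 := by
        have h1 : IsPRDF T (PerfectRoman.glue (branch T x c) (Function.update g c 1)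
            (Function.update f x 1)) :=
          IsPRDF.glue hT.2 hc hgup hfup (Or.inl (by simp)) (Or.inl (by simp))
        have h2 := h.lt_weight h1 ((glue_of_notMem hxc).trans hfx1)
        have h3 := weight_glue (branch T x c) (Function.update g c 1) (Function.update f x 1)
        rw [hfuc] at h3
        omega
      split_ifs with hcy
      · exact hA
      -- If it lost one, then it would already do so with `x` equal to `0`.
      · by_contra! hlt
        have h1 : IsPRDF T (PerfectRoman.glue (branch T x c) (Function.update g c 1) f) := by
          refine IsPRDF.glue hT.2 hc hgup hfP (Or.inl (by simp)) (Or.inr ?_)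
          rw [hg1]
          refine iff_of_false (by decide) fun e => hcy ?_
          exact hfP.eq_of_adj hfx hc e hxy hy2
        have h2 := h.lt_weight h1 ((glue_of_mem (mem_branch_self T x c)).trans hg1)
        have h3 := weight_glue (branch T x c) (Function.update g c 1) f
        omega
    · have h1 : IsPRDF T (PerfectRoman.glue (branch T x c) g (Function.update f x 1)) :=
        IsPRDF.glue hT.2 hc hg hfup (Or.inl hgc) (Or.inl (by simp))
      have h2 := h.lt_weight h1 ((glue_of_notMem hxc).trans hfx1)
      have h3 := weight_glue (branch T x c) g (Function.update f x 1)
      rw [hfuc] at h3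
      omega
  have hsum : ∑ c ∈ Finset.univ.filter (T.Adj x), weightOn (branch T x c) f ≤
      ∑ c ∈ Finset.univ.filter (T.Adj x),
        (weightOn (branch T x c) G + if c = y then 1 else 0) := by
    refine Finset.sum_le_sum fun c hc => ?_
    have hc' : T.Adj x c := (Finset.mem_filter.1 hc).2
    by_cases hcu : c = u
    · subst hcu
      refine (weightOn_congr fun z hz => ?_).le.trans (Nat.le_add_right _ _)
      exact (glue_of_notMem (notMem_branch_symm hT.2 hux hz)).symm
    · exact hbound c hc' hcu
  rw [Finset.sum_add_distrib] at hsum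
  have hone : ∑ c ∈ Finset.univ.filter (T.Adj x), (if c = y then 1 else 0) ≤ 1 := by
    rw [Finset.sum_ite_eq']
    split_ifs <;> simp
  have hwf := weight_eq_add_sum_branch hT x f
  have hwG := weight_eq_add_sum_branch hT x G
  have hGx : G x = 2 := (glue_of_mem hxS).trans hx2
  rw [hfx] at hwf
  rw [hGx] at hwG
  simp only [Fin.val_zero, Fin.val_two] at hwf hwG
  omega

open scoped Classical in
/-- A vertex `v` of value `2` with at least three neighbours of value `0` passes the value `2` on
to one of these neighbours. For let `g` be a minimum weight PRDF of `T - v`, viewed as a PRDF of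
`T`. On each branch at `v` it costs at least as much as `f`, and it has only two units more to spend
on all of them, so on the branch at some neighbour of value `0` it costs the same. There `f` may be
replaced by `g`, which has the value `2` at this neighbour by `IsStable.weightOn_lt`. -/
theorem IsStable.exists_adj_two [DecidableEq V] (h : IsStable T) (hT : T.IsTree)
    (hf : IsMinPRDF T f) (hv : f v = 2)
    (hcard : 3 ≤ (Finset.univ.filter fun z => T.Adj v z ∧ f z = 0).card) :
    ∃ u, T.Adj v u ∧ f u = 0 ∧ ∃ F, IsMinPRDF T F ∧ F v = 2 ∧ F u = 2 := by
  by_contra! hno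
  obtain ⟨hfP, hfw⟩ := hf
  obtain ⟨g, hg, hgv, hgw⟩ := exists_isPRDF_of_induce T v
  rw [h v] at hgw
  have hbound : ∀ c, T.Adj v c →
      weightOn (branch T v c) f + (if f c = 0 then 1 else 0) ≤ weightOn (branch T v c) g := by
    intro c hc
    by_cases hgc : g c = 0
    · by_cases hfc : f c = 0
      · rw [if_pos hfc]
        exact h.weightOn_lt hT ⟨hfP, hfw⟩ hc hv hfc hg hgc (by simp [hgv])
      · rw [if_neg hfc, add_zero]
        have hgup := hg.update_one (x := c) (by simp [hgc])
        have hguw := weightOn_update_one_of_zero (mem_branch_self T v c) hgc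
        have h1 : IsPRDF T (PerfectRoman.glue (branch T v c) (Function.update g c 1) f) :=
          IsPRDF.glue hT.2 hc hgup hfP (Or.inl (by simp)) (Or.inl (by simp [hv]))
        have h2 := h.lt_weight h1 (x := c) ((glue_of_mem (mem_branch_self T v c)).trans (by simp))
        have h3 := weight_glue (branch T v c) (Function.update g c 1) f
        omega
    · have h1 : IsPRDF T (PerfectRoman.glue (branch T v c) g f) :=
        IsPRDF.glue hT.2 hc hg hfP (Or.inl hgc) (Or.inl (by simp [hv]))
      have h2 := prdNumber_le h1
      have h3 := weight_glue (branch T v c) g f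
      have hvc : v ∉ branch T v c := fun hS => ne_of_mem_branch hc.ne' hS rfl
      split_ifs with hfc
      · by_contra! hlt
        have hw : weight (PerfectRoman.glue (branch T v c) g f) = prdNumber T := by omega
        refine hno c hc hfc _ ⟨h1, hw⟩ ((glue_of_notMem hvc).trans hv)
          ((glue_of_mem (mem_branch_self T v c)).trans (eq_two_of_ne hgc fun e => ?_))
        exact h.ne_one h1 hw.le c ((glue_of_mem (mem_branch_self T v c)).trans e)
      · omega
  have hsum := Finset.sum_le_sum fun c (hc : c ∈ Finset.univ.filter (T.Adj v)) =>
    hbound c (Finset.mem_filter.1 hc).2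
  rw [Finset.sum_add_distrib, ← Finset.card_filter, Finset.filter_filter] at hsum
  have hwf := weight_eq_add_sum_branch hT v f
  have hwg := weight_eq_add_sum_branch hT v g
  rw [hv] at hwf
  rw [hgv] at hwg
  simp only [Fin.val_one, Fin.val_two] at hwf hwg
  omega

/-- Suppose that `v` and `w` have value `2`. Moving away from `v`, we reach an edge of the same kind
such that `v` is the only neighbour of value `2` of `w`, and `w` has at most two neighbours of
value `0`. There, `w` may get the value `0` and these neighbours the value `1`. -/
theorem IsStable.not_adj_two_two [DecidableEq V] (h : IsStable T) (hT : T.IsTree) :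
    ∀ f v w, IsMinPRDF T f → T.Adj v w → f v = 2 → f w ≠ 2 := by
  classical
  suffices key : ∀ (n : ℕ) f v w, (branch T v w).ncard = n → IsMinPRDF T f → T.Adj v w →
      f v = 2 → f w ≠ 2 from fun f v w => key _ f v w rfl
  intro n
  induction n using Nat.strong_induction_on with
  | _ n ih =>
  intro f v w hn hf hvw hv hw
  have descend : ∀ F u, IsMinPRDF T F → T.Adj w u → u ≠ v → F w = 2 → F u ≠ 2 :=
    fun F u hF hu huv => ih _ (hn ▸ Set.ncard_lt_ncard
      (branch_ssubset_branch hT.2 hvw hu huv) (Set.toFinite _)) F w u rfl hF hu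
  have hcard : (Finset.univ.filter fun z => T.Adj w z ∧ f z = 0).card ≤ 2 := by
    by_contra! hlt
    obtain ⟨u, hu, hu0, F, hF, hFw, hFu⟩ := h.exists_adj_two hT hf hw hlt
    exact descend F u hF hu (by rintro rfl; simp [hv] at hu0) hFw hFu
  have hF : IsPRDF T (dissolve T f w 0) := by
    intro z
    by_cases hz : z = w
    · subst hz
      intro _
      refine ⟨v, ⟨hvw.symm, (dissolve_eq_two_iff 0 hvw.ne).2 hv⟩, fun y hy => ?_⟩
      by_contra hyv
      exact descend f y hf hy.1 hyv hw ((dissolve_eq_two_iff 0 hy.1.ne').1 hy.2)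
    · exact dissolve_dominatedAt hf.1 0 hz
  have h1 := weight_dissolve (G := T) hw 0
  have h2 := prdNumber_le hF
  have h3 := hf.2
  rw [Fin.val_zero] at h1
  obtain ⟨u, hu⟩ : (Finset.univ.filter fun z => T.Adj w z ∧ f z = 0).Nonempty := by
    rw [← Finset.card_pos]
    omega
  have hu' := (Finset.mem_filter.1 hu).2
  exact h.ne_one hF (by omega) u (dissolve_adj 0 hu'.1 hu'.2)

theorem IsStable.isPathPartition [DecidableEq V] (h : IsStable T) (hT : T.IsTree)
    (hf : IsMinPRDF T f) : IsPathPartition T f where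
  isPRDF := hf.1
  ne_one := h.ne_one hf.1 hf.2.le
  center := by
    classical
    intro v hv
    have hadj : ∀ z, T.Adj v z → f z = 0 := fun z hz => by
      by_contra h0
      exact h.not_adj_two_two hT f v z hf hz hv
        (eq_two_of_ne h0 (h.ne_one hf.1 hf.2.le z))
    have hle : (Finset.univ.filter fun z => T.Adj v z ∧ f z = 0).card ≤ 2 := by
      by_contra! hlt
      obtain ⟨u, hu, -, F, hF, hFw, hFu⟩ := h.exists_adj_two hT hf hv hlt
      exact h.not_adj_two_two hT F v u hF hu hFw hFu
    have hF : IsPRDF T (dissolve T f v 1) := by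
      intro z
      by_cases hz : z = v
      · exact dominatedAt_of_ne (by simp [hz, dissolve_self])
      · exact dissolve_dominatedAt hf.1 1 hz
    have h1 := weight_dissolve (G := T) hv 1
    have h2 := h.lt_weight hF (dissolve_self v 1)
    have h3 := hf.2
    rw [Fin.val_one] at h1
    obtain ⟨p, q, hpq, he⟩ := Finset.card_eq_two.1 (hle.antisymm (by omega))
    have hmem : ∀ z, T.Adj v z ↔ z = p ∨ z = q := fun z => by
      have := Finset.ext_iff.1 he z
      simp only [Finset.mem_filter, Finset.mem_univ, true_and, Finset.mem_insert,
        Finset.mem_singleton] at this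
      exact ⟨fun hz => this.1 ⟨hz, hadj z hz⟩, fun hz => (this.2 hz).1⟩
    exact ⟨p, q, hpq, hadj p ((hmem p).2 (Or.inl rfl)), hadj q ((hmem q).2 (Or.inr rfl)), hmem⟩

end Stable

/-! ### Pendant paths of a path partition -/

section Pendant

variable {V : Type u} {T : SimpleGraph V} {f : V → Fin 3} {x y b a : V}

/-- `y`, `b`, `a` are the consecutive vertices of a path that is attached to the rest of the graph
by the edge `xy` only. -/
structure IsPendantPath (T : SimpleGraph V) (x y b a : V) : Prop where
  ne_xb : x ≠ b
  ne_xa : x ≠ a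
  ne_ya : y ≠ a
  adj_y : ∀ z, T.Adj y z ↔ z = x ∨ z = b
  adj_b : ∀ z, T.Adj b z ↔ z = y ∨ z = a
  adj_a : ∀ z, T.Adj a z ↔ z = b

/-- If the edge `xy` between vertices of value `0` is chosen with a minimal branch at `y`, then this
branch is a pendant path. -/
theorem IsPathPartition.exists_isPendantPath [Finite V] (hf : IsPathPartition T f)
    (hT : T.IsAcyclic) (h : ∃ x y, T.Adj x y ∧ f x = 0 ∧ f y = 0) :
    ∃ x y b a, IsPendantPath T x y b a ∧ f x = 0 ∧ f y = 0 ∧ f b = 2 ∧ f a = 0 := by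
  obtain ⟨x₀, y₀, h₀⟩ := h
  obtain ⟨⟨x, y⟩, ⟨hxy, hx, hy⟩, hmin⟩ := Set.exists_min_image
    {p : V × V | T.Adj p.1 p.2 ∧ f p.1 = 0 ∧ f p.2 = 0}
    (fun p => (branch T p.1 p.2).ncard) (Set.toFinite _) ⟨(x₀, y₀), h₀⟩
  dsimp only at hxy hx hy
  have hmin' : ∀ c d, T.Adj c d → f c = 0 → f d = 0 → ¬ branch T c d ⊂ branch T x y :=
    fun c d hcd hc hd hlt =>
      absurd (hmin (c, d) ⟨hcd, hc, hd⟩) (Set.ncard_lt_ncard hlt (Set.toFinite _)).not_ge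
  obtain ⟨b, ⟨hyb, hb⟩, hbuniq⟩ := hf.isPRDF y hy
  obtain ⟨a, hya, ha, hadjb⟩ : ∃ a, y ≠ a ∧ f a = 0 ∧ ∀ z, T.Adj b z ↔ z = y ∨ z = a := by
    obtain ⟨p, q, hpq, hp, hq, hpqb⟩ := hf.center b hb
    rcases (hpqb y).1 hyb.symm with rfl | rfl
    · exact ⟨q, hpq, hq, hpqb⟩
    · exact ⟨p, hpq.symm, hp, fun z => (hpqb z).trans or_comm⟩
  have hba : T.Adj b a := (hadjb a).2 (Or.inr rfl)
  have hxb : x ≠ b := by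
    rintro rfl
    simp [hx] at hb
  have hadja : ∀ z, T.Adj a z ↔ z = b := by
    refine fun z => ⟨fun hz => ?_, fun e => e ▸ hba.symm⟩
    by_cases hz0 : f z = 0
    · have hzb : z ≠ b := by
        rintro rfl
        simp [hz0] at hb
      exact absurd (((branch_ssubset_branch hT hba hz hzb).trans
        (branch_ssubset_branch hT hyb hba hya.symm)).trans
        (branch_ssubset_branch hT hxy hyb hxb.symm)) (hmin' a z hz ha hz0)
    · exact hf.isPRDF.eq_of_adj ha hz (eq_two_of_ne hz0 (hf.ne_one z)) hba.symm hb
  refine ⟨x, y, b, a, ⟨hxb, ?_, hya, fun z => ⟨fun hz => ?_, ?_⟩, hadjb, hadja⟩, hx, hy, hb, ha⟩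
  · rintro rfl
    rw [(hadja y).1 hxy, hb] at hy
    simp at hy
  · by_cases hz0 : f z = 0
    · by_contra hne
      exact hmin' y z hz hy hz0 (branch_ssubset_branch hT hxy hz fun e => hne (Or.inl e))
    · exact Or.inr (hbuniq z ⟨hz, eq_two_of_ne hz0 (hf.ne_one z)⟩)
  · rintro (rfl | rfl)
    · exact hxy.symm
    · exact hyb

/-- Without edges between vertices of value `0`, the partition consists of one path only. -/
theorem IsPathPartition.exists_iso (hf : IsPathPartition T f) (hT : T.Connected)
    (h : ∀ x y, T.Adj x y → f x = 0 → f y ≠ 0) :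
    ∃ e : T ≃g SimpleGraph.pathGraph 3, f = pathFun ∘ e := by
  obtain ⟨b, hb⟩ : ∃ b, f b = 2 := by
    obtain ⟨z⟩ := hT.nonempty
    by_cases hz : f z = 0
    · obtain ⟨b, hb, -⟩ := hf.isPRDF z hz
      exact ⟨b, hb.2⟩
    · exact ⟨z, eq_two_of_ne hz (hf.ne_one z)⟩
  obtain ⟨p, q, hpq, hp, hq, hadj⟩ := hf.center b hb
  have hadj0 : ∀ c, T.Adj b c → f c = 0 → ∀ z, T.Adj c z ↔ z = b := by
    refine fun c hbc hc z => ⟨fun hz => ?_, fun e => e ▸ hbc.symm⟩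
    exact hf.isPRDF.eq_of_adj hc hz (eq_two_of_ne (h c z hz hc) (hf.ne_one z)) hbc.symm hb
  have hadjp := hadj0 p ((hadj p).2 (Or.inl rfl)) hp
  have hadjq := hadj0 q ((hadj q).2 (Or.inr rfl)) hq
  have hpb : p ≠ b := ((hadj p).2 (Or.inl rfl)).ne'
  have hqb : q ≠ b := ((hadj q).2 (Or.inr rfl)).ne'
  have hall : ∀ z, z = p ∨ z = b ∨ z = q := by
    intro z
    have hz := hT.preconnected b z
    rw [SimpleGraph.reachable_iff_reflTransGen] at hz
    induction hz with
    | refl => exact Or.inr (Or.inl rfl)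
    | tail _ hcd ih =>
      rcases ih with rfl | rfl | rfl
      · exact Or.inr (Or.inl ((hadjp _).1 hcd))
      · rcases (hadj _).1 hcd with e | e
        · exact Or.inl e
        · exact Or.inr (Or.inr e)
      · exact Or.inr (Or.inl ((hadjq _).1 hcd))
  let φ : Fin 3 → V := ![p, b, q]
  have hφ : Function.Bijective φ := by
    constructor
    · intro i j hij
      fin_cases i <;> fin_cases j <;>
        simp [φ, hpq, hpq.symm, hpb, hpb.symm, hqb, hqb.symm] at hij ⊢
    · intro z
      rcases hall z with rfl | rfl | rfl
      exacts [⟨0, rfl⟩, ⟨1, rfl⟩, ⟨2, rfl⟩]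
  let e : SimpleGraph.pathGraph 3 ≃g T :=
    { toEquiv := Equiv.ofBijective φ hφ
      map_rel_iff' := by
        intro i j
        fin_cases i <;> fin_cases j <;>
          simp [φ, SimpleGraph.pathGraph_adj, hadj, hadjp, hadjq, hpb, hqb] }
  refine ⟨e.symm, ?_⟩
  have h1 : f ∘ e = pathFun := by
    ext i
    fin_cases i
    exacts [congrArg _ hp, congrArg _ hb, congrArg _ hq]
  ext z
  rw [← h1]
  simp

theorem IsPendantPath.ne_yb (h : IsPendantPath T x y b a) : y ≠ b :=
  ((h.adj_y b).2 (Or.inr rfl)).ne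

theorem IsPendantPath.ne_ba (h : IsPendantPath T x y b a) : b ≠ a :=
  ((h.adj_b a).2 (Or.inr rfl)).ne

theorem IsPendantPath.ne_xy (h : IsPendantPath T x y b a) : x ≠ y :=
  ((h.adj_y x).2 (Or.inl rfl)).ne'

/-- The vertices off the path. -/
def IsPendantPath.rest (_ : IsPendantPath T x y b a) : Set V := {z | z ≠ y ∧ z ≠ b ∧ z ≠ a}

/-- The vertex of attachment, as a vertex off the path. -/
def IsPendantPath.root (h : IsPendantPath T x y b a) : h.rest := ⟨x, h.ne_xy, h.ne_xb, h.ne_xa⟩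

theorem IsPendantPath.isTree_rest (h : IsPendantPath T x y b a) (hT : T.IsTree) :
    (T.induce h.rest).IsTree := by
  classical
  have : Nonempty h.rest := ⟨h.root⟩
  refine ⟨⟨fun u v => ?_⟩, hT.2.induce _⟩
  -- Contracting the path to its vertex of attachment maps walks to walks.
  let φ : V → h.rest := fun z => if hz : z ∈ h.rest then ⟨z, hz⟩ else h.root
  have hφ : ∀ z : h.rest, φ z = z := fun z => dif_pos z.2
  have hφ' : ∀ z, z ∉ h.rest → φ z = h.root := fun z hz => dif_neg hz
  have hout : ∀ c d, T.Adj c d → c ∈ h.rest → d ∉ h.rest → c = x := by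
    intro c d hcd hc hd
    have hd' : d = y ∨ d = b ∨ d = a := by
      by_contra hne
      exact hd (by simpa [IsPendantPath.rest, not_or] using hne)
    rcases hd' with rfl | rfl | rfl
    · exact ((h.adj_y c).1 hcd.symm).resolve_right hc.2.1
    · exact absurd ((h.adj_b c).1 hcd.symm) (by simp [hc.1, hc.2.2])
    · exact absurd ((h.adj_a c).1 hcd.symm) hc.2.1
  have key : ∀ c d, T.Adj c d → (T.induce h.rest).Reachable (φ c) (φ d) := by
    intro c d hcd
    by_cases hc : c ∈ h.rest <;> by_cases hd : d ∈ h.rest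
    · rw [hφ ⟨c, hc⟩, hφ ⟨d, hd⟩]
      exact SimpleGraph.Adj.reachable (G := T.induce h.rest) hcd
    · rw [hφ ⟨c, hc⟩, hφ' d hd,
        show (⟨c, hc⟩ : h.rest) = h.root from Subtype.ext (hout c d hcd hc hd)]
    · rw [hφ ⟨d, hd⟩, hφ' c hc,
        show (⟨d, hd⟩ : h.rest) = h.root from Subtype.ext (hout d c hcd.symm hd hc)]
    · rw [hφ' c hc, hφ' d hd]
  have hreach : ∀ d, T.Reachable u d → (T.induce h.rest).Reachable u (φ d) := by
    intro d hd
    rw [SimpleGraph.reachable_iff_reflTransGen] at hd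
    induction hd with
    | refl => rw [hφ]
    | tail _ hcd ih => exact ih.trans (key _ _ hcd)
  exact hφ v ▸ hreach v (hT.1.preconnected u v)

theorem IsPendantPath.isPathPartition_rest (h : IsPendantPath T x y b a)
    (hf : IsPathPartition T f) (hx : f x = 0) (hy : f y = 0) (ha : f a = 0) :
    IsPathPartition (T.induce h.rest) (fun z => f z) where
  isPRDF z hz := by
    obtain ⟨d, ⟨hd, hd2⟩, huniq⟩ := hf.isPRDF z hz
    have hdr : d ∈ h.rest := by
      refine ⟨?_, ?_, ?_⟩
      · rintro rfl
        simp [hy] at hd2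
      · rintro rfl
        exact absurd ((h.adj_b z).1 hd.symm) (by simp [z.2.1, z.2.2.2])
      · rintro rfl
        simp [ha] at hd2
    exact ⟨⟨d, hdr⟩, ⟨hd, hd2⟩, fun w hw => Subtype.ext (huniq w hw)⟩
  ne_one z := hf.ne_one z
  center z hz := by
    obtain ⟨p, q, hpq, hp, hq, hadj⟩ := hf.center z hz
    have hr : ∀ w, T.Adj z w → w ∈ h.rest := by
      intro w hw
      refine ⟨?_, ?_, ?_⟩
      · rintro rfl
        rcases (h.adj_y z).1 hw.symm with e | e
        · rw [e, hx] at hz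
          simp at hz
        · exact z.2.2.1 e
      · rintro rfl
        exact absurd ((h.adj_b z).1 hw.symm) (by simp [z.2.1, z.2.2.2])
      · rintro rfl
        exact z.2.2.1 ((h.adj_a z).1 hw.symm)
    refine ⟨⟨p, hr p ((hadj p).2 (Or.inl rfl))⟩, ⟨q, hr q ((hadj q).2 (Or.inr rfl))⟩,
      fun e => hpq (congrArg Subtype.val e), hp, hq, fun w => ?_⟩
    rw [Subtype.ext_iff, Subtype.ext_iff]
    exact hadj w

theorem IsPendantPath.exists_iso (h : IsPendantPath T x y b a) (hy : f y = 0) (hb : f b = 2)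
    (ha : f a = 0) :
    ∃ e : T ≃g attachPath (T.induce h.rest) h.root,
      f = Sum.elim (fun z : h.rest => f z) pathFun ∘ e := by
  let φ : h.rest ⊕ Fin 3 → V := Sum.elim Subtype.val ![y, b, a]
  have hφ : Function.Bijective φ := by
    constructor
    · rintro (i | i) (j | j) hij
      · exact congrArg Sum.inl (Subtype.ext hij)
      · have := i.2
        fin_cases j
        exacts [absurd hij this.1, absurd hij this.2.1, absurd hij this.2.2]
      · have := j.2
        fin_cases i
        exacts [absurd hij.symm this.1, absurd hij.symm this.2.1, absurd hij.symm this.2.2]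
      · fin_cases i <;> fin_cases j <;>
          simp [φ, h.ne_yb, h.ne_yb.symm, h.ne_ya, h.ne_ya.symm, h.ne_ba, h.ne_ba.symm] at hij ⊢
    · intro z
      by_cases hz : z ∈ h.rest
      · exact ⟨Sum.inl ⟨z, hz⟩, rfl⟩
      · have hz' : z = y ∨ z = b ∨ z = a := by
          by_contra hne
          exact hz (by simpa [IsPendantPath.rest, not_or] using hne)
        rcases hz' with rfl | rfl | rfl
        exacts [⟨Sum.inr 0, rfl⟩, ⟨Sum.inr 1, rfl⟩, ⟨Sum.inr 2, rfl⟩]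
  have hlr : ∀ (i : h.rest) (j : Fin 3),
      T.Adj (![y, b, a] j) i ↔ i = h.root ∧ j = 0 := by
    intro i j
    rw [Subtype.ext_iff]
    have := i.2
    fin_cases j
    · simp [h.adj_y, this.2.1, IsPendantPath.root]
    · simp [h.adj_b, this.1, this.2.2]
    · simp [h.adj_a, this.2.1]
  let e : attachPath (T.induce h.rest) h.root ≃g T :=
    { toEquiv := Equiv.ofBijective φ hφ
      map_rel_iff' := by
        rintro (i | i) (j | j)
        · rw [attachPath_adj_inl_inl]
          rfl
        · rw [attachPath_adj_inl_inr, ← hlr i j, SimpleGraph.adj_comm]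
          rfl
        · rw [attachPath_adj_inr_inl, ← hlr j i]
          rfl
        · rw [attachPath_adj_inr_inr]
          fin_cases i <;> fin_cases j <;>
            simp [φ, SimpleGraph.pathGraph_adj, h.adj_y, h.adj_b, h.adj_a, h.ne_yb, h.ne_ya,
              h.ne_xa.symm, h.ne_ya.symm, h.ne_ba.symm] }
  refine ⟨e.symm, ?_⟩
  have h1 : f ∘ e = Sum.elim (fun z : h.rest => f z) pathFun := by
    funext i
    rcases i with i | i
    · rfl
    · fin_cases i
      exacts [hy, hb, ha]
  ext z
  rw [← h1]
  simp

end Pendant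

/-- A tree with a path partition arises from a path by attaching pendant paths. Rigidity is carried
along, as it identifies the set `W` of the smaller tree. -/
theorem IsPathPartition.inFamily_and_isRigid {V : Type u} [Fintype V] {T : SimpleGraph V}
    {f : V → Fin 3} (hT : T.IsTree) (hf : IsPathPartition T f) : InFamily T ∧ IsRigid T f := by
  classical
  induction hn : Fintype.card V using Nat.strong_induction_on generalizing V with
  | _ n ih =>
  by_cases h : ∃ x y, T.Adj x y ∧ f x = 0 ∧ f y = 0
  · obtain ⟨x, y, b, a, hp, hx, hy, hb, ha⟩ := hf.exists_isPendantPath hT.2 h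
    have hf' := hp.isPathPartition_rest hf hx hy ha
    have hcard : Fintype.card hp.rest < n :=
      hn ▸ Fintype.card_subtype_lt (x := y) fun hy' => hy'.1 rfl
    obtain ⟨hfam, hrig⟩ := ih _ hcard (hp.isTree_rest hT) hf' rfl
    obtain ⟨e, he⟩ := hp.exists_iso hy hb ha
    have hroot : hp.root ∈ zeroSet (T.induce hp.rest) := fun g hg => by
      rw [hrig.eq_of_isMinPRDF hf'.isPRDF hg]
      exact hx
    refine ⟨InFamily.step _ _ hfam hp.root hroot e, ?_⟩
    rw [he]
    exact (hrig.attachPath hf'.isPRDF hx).comp_iso e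
  · push Not at h
    obtain ⟨e, rfl⟩ := hf.exists_iso hT.1 h
    exact ⟨InFamily.base T e, isRigid_pathFun.comp_iso e⟩

end PerfectRoman

theorem theorem1 {V : Type*} [Fintype V] [DecidableEq V] (T : SimpleGraph V)
    (hT : T.IsTree) (hn : 3 ≤ Fintype.card V) :
    PerfectRoman.IsStable T ↔ PerfectRoman.InFamily T := by
  constructor
  · intro h
    obtain ⟨f, hf⟩ := PerfectRoman.exists_isMinPRDF T
    exact ((h.isPathPartition hT hf).inFamily_and_isRigid hT).1
  · intro h
    obtain ⟨f, hf, hr⟩ := h.exists_isPathPartition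
    exact hf.isStable hr
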